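/- Let $\mathbb K$ be a field and $S=\mathbb K[x_1,\dots,x_n]$ with its standard $\mathbb Z^n$-grading. For a $\mathbb Z^n$-graded squarefree $S$-module $M$, a squarefree Stanley decomposition of $M$ is a presentation $\mathcal D\colon M=\bigoplus_{i=1}^r u_i\mathbb K[Z_i]$ as a finite direct sum of $\mathbb K$-subspaces, where $Z_i\subseteq\{x_1,\dots,x_n\}$, each $u_i\in M$ is homogeneous of a $0/1$-degree whose support is contained in $Z_i$, and $u_i\mathbb K[Z_i]$, the $\mathbb K$-span of all $u_iv$ with $v$ a monomial in $\mathbb K[Z_i]$, is a free $\mathbb K[Z_i]$-module with basis $u_i$. Let $\operatorname{sreg}(\mathcal D)=\max_i \deg(u_i)$, where $\deg$ is the total degree, and let the Stanley regularity $\operatorname{sreg}(M)$ be the minimum of $\operatorname{sreg}(\mathcal D)$ over all squarefree Stanley decompositions $\mathcal D$ of $M$ (with $\operatorname{sreg}(0)=0$). Let $I_1,\dots,I_s$ be squarefree monomial ideals of $S$, that is, ideals generated by squarefree monomials. Then \[ \text{(a)}\quad \operatorname{sreg}\Bigl(S\Big/\sum_{i=1}^s I_i\Bigr)\le\sum_{i=1}^s\operatorname{sreg}(S/I_i),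 \qquad \text{(b)}\quad \operatorname{sreg}\Bigl(\bigcap_{i=1}^s I_i\Bigr)\le\sum_{i=1}^s\operatorname{sreg}(I_i). \] -/

import Mathlib

/-- The squarefree monomial `x^A`, the product of the variables in `A`, in `K[x_1, …, x_n]`. -/
noncomputable def sqfreeMonomial (K : Type*) [Field K] {n : ℕ} (A : Finset (Fin n)) :
    MvPolynomial (Fin n) K :=
  ∏ i ∈ A, MvPolynomial.X i

/-- A squarefree monomial ideal: an ideal generated by a set of squarefree monomials.
The zero ideal (no generators) and the unit ideal (generator `x^∅ = 1`) are included. -/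
def IsSquarefreeMonomialIdeal {K : Type*} [Field K] {n : ℕ}
    (I : Ideal (MvPolynomial (Fin n) K)) : Prop :=
  ∃ E : Set (Finset (Fin n)), I = Ideal.span (sqfreeMonomial K '' E)

/-- The `K`-subspace `u K[Z]` of an `S`-module `M`: the span of all `v • u` with `v` a monomial
in the variables of `Z`. -/
def stanleySpace {K : Type*} [Field K] {n : ℕ} {M : Type*} [AddCommGroup M] [Module K M]
    [Module (MvPolynomial (Fin n) K) M] [IsScalarTower K (MvPolynomial (Fin n) K) M]
    (u : M) (Z : Finset (Fin n)) : Submodule K M :=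
  Submodule.span K
    {m : M | ∃ b : Fin n →₀ ℕ, b.support ⊆ Z ∧ m = MvPolynomial.monomial b (1 : K) • u}

/-- A squarefree Stanley decomposition `M = ⨁ u_i K[Z_i]` (finite, internal direct sum of
`K`-vector spaces) of a multigraded `S`-module `M` with graded components `ℳ a`.
Each `u_i` is homogeneous of a squarefree degree whose support lies in `Z_i`, and each summand
is a Stanley space, i.e. `u_i K[Z_i]` is a free `K[Z_i]`-module with basis `u_i`. -/
structure SquarefreeStanleyDecomposition {K : Type*} [Field K] {n : ℕ} {M : Type*}
    [AddCommGroup M] [Module K M] [Module (MvPolynomial (Fin n) K) M]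
    [IsScalarTower K (MvPolynomial (Fin n) K) M]
    (ℳ : (Fin n →₀ ℕ) → Submodule K M) where
  /-- the number of summands -/
  r : ℕ
  /-- the generators `u_i` -/
  u : Fin r → M
  /-- the multidegrees of the `u_i` -/
  deg : Fin r → (Fin n →₀ ℕ)
  /-- the sets of variables `Z_i` -/
  Z : Fin r → Finset (Fin n)
  homogeneous : ∀ i, u i ∈ ℳ (deg i)
  deg_squarefree : ∀ i j, deg i j ≤ 1
  support_subset : ∀ i, (deg i).support ⊆ Z i
  free : ∀ i, ∀ f ∈ MvPolynomial.supported K (Z i : Set (Fin n)), f • u i = 0 → f = 0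
  isInternal : DirectSum.IsInternal fun i => stanleySpace (K := K) (u i) (Z i)

/-- The Stanley regularity of a decomposition: the largest total degree of a generator `u_i`
(`0` for the empty decomposition of the zero module). -/
noncomputable def SquarefreeStanleyDecomposition.sreg {K : Type*} [Field K] {n : ℕ} {M : Type*}
    [AddCommGroup M] [Module K M] [Module (MvPolynomial (Fin n) K) M]
    [IsScalarTower K (MvPolynomial (Fin n) K) M]
    {ℳ : (Fin n →₀ ℕ) → Submodule K M} (D : SquarefreeStanleyDecomposition ℳ) : ℕ :=
  Finset.univ.sup fun i => (D.deg i).degree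

/-- The Stanley regularity of a multigraded module: the minimum over all its squarefree Stanley
decompositions. (The minimum in `ℕ∞` would be `⊤` if there were no such decomposition.) -/
noncomputable def stanleyRegularity {K : Type*} [Field K] {n : ℕ} {M : Type*}
    [AddCommGroup M] [Module K M] [Module (MvPolynomial (Fin n) K) M]
    [IsScalarTower K (MvPolynomial (Fin n) K) M]
    (ℳ : (Fin n →₀ ℕ) → Submodule K M) : ℕ∞ :=
  ⨅ D : SquarefreeStanleyDecomposition ℳ, (D.sreg : ℕ∞)

/-- The component `K x^a` of degree `a` of the polynomial ring. -/
noncomputable def polyComponent (K : Type*) [Field K] {n : ℕ} (a : Fin n →₀ ℕ) :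
    Submodule K (MvPolynomial (Fin n) K) :=
  Submodule.span K {MvPolynomial.monomial a (1 : K)}

/-- The multigrading of an ideal `I` as an `S`-module: `I_a = I ∩ K x^a`. -/
noncomputable def idealComponent {K : Type*} [Field K] {n : ℕ}
    (I : Ideal (MvPolynomial (Fin n) K)) (a : Fin n →₀ ℕ) : Submodule K I :=
  (polyComponent K a).comap (I.subtype.restrictScalars K)

/-- The multigrading of `S/I`: `(S/I)_a` is the image of `K x^a`. -/
noncomputable def quotientComponent {K : Type*} [Field K] {n : ℕ}
    (I : Ideal (MvPolynomial (Fin n) K)) (a : Fin n →₀ ℕ) :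
    Submodule K (MvPolynomial (Fin n) K ⧸ I) :=
  (polyComponent K a).map (Ideal.Quotient.mkₐ K I).toLinearMap

/-- `sreg(I)`, for an ideal `I` regarded as a multigraded module. -/
noncomputable def sregIdeal {K : Type*} [Field K] {n : ℕ}
    (I : Ideal (MvPolynomial (Fin n) K)) : ℕ∞ :=
  stanleyRegularity (idealComponent I)

/-- `sreg(S/I)`. -/
noncomputable def sregQuotient {K : Type*} [Field K] {n : ℕ}
    (I : Ideal (MvPolynomial (Fin n) K)) : ℕ∞ :=
  stanleyRegularity (quotientComponent I)

/-! For a squarefree monomial ideal `I`, the multigraded components of `I` and of `S/I` have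
dimension at most one, and whether the component of degree c vanishes depends only on supp c. Let P
be the family of supports of nonzero components. A squarefree Stanley space with generator of degree
a is spanned by the basis monomials whose support lies in the interval [supp a, Z]. Squarefree
Stanley decompositions thus amount to partitions of P into intervals [A, Z], and the Stanley
regularity is the largest #A (`hasIntervalPartition`, `exists_decomposition`).

Partitions of P_1, …, P_s have a common refinement on their intersection, with intervals [⋃ A_i, ⋂
Z_i] and #(⋃ A_i) ≤ ∑ #A_i (`HasIntervalPartition.iInter`). Both inequalities follow: a monomial is
nonzero modulo the sum of the ideals iff it is nonzero modulo each of them, and it lies in the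
intersection iff it lies in each of them. -/

/-! ### Interval partitions of families of finite sets -/

/-- The family `P` is a disjoint union of intervals `[A, Z]` of finite sets with `#A ≤ d`.
The functions `lo` and `hi` send a member of `P` to the bounds of the interval it lies in. -/
def HasIntervalPartition {α : Type*} (P : Set (Finset α)) (d : ℕ) : Prop :=
  ∃ lo hi : Finset α → Finset α, ∀ B ∈ P, lo B ⊆ B ∧ B ⊆ hi B ∧ (lo B).card ≤ d ∧
    ∀ C, lo B ⊆ C → C ⊆ hi B → C ∈ P ∧ lo C = lo B ∧ hi C = hi B

/-- Interval partitions of finitely many families induce one of their intersection. -/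
theorem HasIntervalPartition.iInter {α ι : Type*} [Fintype α] [Fintype ι]
    {P : ι → Set (Finset α)} {d : ι → ℕ} (h : ∀ i, HasIntervalPartition (P i) (d i)) :
    HasIntervalPartition (⋂ i, P i) (∑ i, d i) := by
  classical
  choose lo hi h using h
  -- The intersection of the intervals [A_i, Z_i] is [⋃ A_i, ⋂ Z_i]. For an empty index type this is
  -- [∅, univ], the whole power set.
  refine ⟨fun B => Finset.univ.biUnion fun i => lo i B, fun B => Finset.univ.inf fun i => hi i B,
    fun B hB => ?_⟩
  rw [Set.mem_iInter] at hB
  refine ⟨?_, ?_, ?_, fun C hC hC' => ?_⟩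
  · exact Finset.biUnion_subset.2 fun i _ => (h i B (hB i)).1
  · exact Finset.le_inf fun i _ => (h i B (hB i)).2.1
  · exact Finset.card_biUnion_le.trans (Finset.sum_le_sum fun i _ => (h i B (hB i)).2.2.1)
  · have key : ∀ i, C ∈ P i ∧ lo i C = lo i B ∧ hi i C = hi i B := fun i =>
      (h i B (hB i)).2.2.2 C (Finset.biUnion_subset.1 hC i (Finset.mem_univ i))
        (hC'.trans (Finset.inf_le (f := fun i => hi i B) (Finset.mem_univ i)))
    refine ⟨Set.mem_iInter.2 fun i => (key i).1, ?_, ?_⟩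
    · simp only [fun i => (key i).2.1]
    · simp only [fun i => (key i).2.2]

/-! ### Squarefree exponents and the degrees in a Stanley space -/

/-- The `0/1`-vector with support `A`. -/
noncomputable def indicatorExponent {n : ℕ} (A : Finset (Fin n)) : Fin n →₀ ℕ :=
  Finsupp.indicator A fun _ _ => 1

theorem indicatorExponent_apply {n : ℕ} (A : Finset (Fin n)) (j : Fin n) :
    indicatorExponent A j = if j ∈ A then 1 else 0 := by
  simp [indicatorExponent, Finsupp.indicator_apply]

@[simp]
theorem support_indicatorExponent {n : ℕ} (A : Finset (Fin n)) :
    (indicatorExponent A).support = A := by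
  ext j
  simp [indicatorExponent_apply]

theorem degree_indicatorExponent {n : ℕ} (A : Finset (Fin n)) :
    (indicatorExponent A).degree = A.card := by
  rw [Finsupp.degree_apply, support_indicatorExponent, Finset.card_eq_sum_ones]
  exact Finset.sum_congr rfl fun j hj => by simp [indicatorExponent_apply, hj]

theorem card_support_le_degree {n : ℕ} (a : Fin n →₀ ℕ) : a.support.card ≤ a.degree := by
  rw [Finsupp.degree_apply, Finset.card_eq_sum_ones]
  exact Finset.sum_le_sum fun j hj => Nat.one_le_iff_ne_zero.2 (Finsupp.mem_support_iff.1 hj)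

/-- The degrees of the monomials in `x^a K[Z]`. -/
def stanleyDegrees {n : ℕ} (a : Fin n →₀ ℕ) (Z : Finset (Fin n)) : Set (Fin n →₀ ℕ) :=
  {c | ∃ b : Fin n →₀ ℕ, b.support ⊆ Z ∧ c = b + a}

/-- Since a is a 0/1-vector, x^a divides x^c as soon as supp a ⊆ supp c. This is what turns Stanley
spaces into intervals of sets. -/
theorem mem_stanleyDegrees_iff {n : ℕ} {a : Fin n →₀ ℕ} {Z : Finset (Fin n)}
    (ha : ∀ j, a j ≤ 1) (haZ : a.support ⊆ Z) {c : Fin n →₀ ℕ} :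
    c ∈ stanleyDegrees a Z ↔ a.support ⊆ c.support ∧ c.support ⊆ Z := by
  classical
  constructor
  · rintro ⟨b, hb, rfl⟩
    refine ⟨fun j hj => ?_, Finsupp.support_add.trans (Finset.union_subset hb haZ)⟩
    simp only [Finsupp.mem_support_iff, Finsupp.add_apply] at hj ⊢
    omega
  · rintro ⟨h1, h2⟩
    refine ⟨c - a, fun j hj => h2 ?_, (tsub_add_cancel_of_le fun j => ?_).symm⟩
    · simp only [Finsupp.mem_support_iff, Finsupp.tsub_apply] at hj ⊢
      omega
    · by_cases hj : a j = 0
      · simp [hj]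
      · exact (ha j).trans (Nat.one_le_iff_ne_zero.2
          (Finsupp.mem_support_iff.1 (h1 (Finsupp.mem_support_iff.2 hj))))

/-! ### Modules spanned by monomials -/

theorem LinearIndepOn.mem_of_mem_span_image {ι K M : Type*} [Ring K] [Nontrivial K]
    [AddCommGroup M] [Module K M] {e : ι → M} {s t : Set ι} (h : LinearIndepOn K e s)
    (hts : t ⊆ s) {c : ι} (hc : c ∈ s) (hmem : e c ∈ Submodule.span K (e '' t)) : c ∈ t := by
  by_contra hct
  exact (h.mono (Set.insert_subset hc hts)).notMem_span_of_insert hct hmem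

theorem LinearIndepOn.disjoint_span_image_of_disjoint {ι K M : Type*} [Ring K]
    [AddCommGroup M] [Module K M] {e : ι → M} {s t t' : Set ι} (h : LinearIndepOn K e s)
    (ht : t ⊆ s) (ht' : t' ⊆ s) (hd : Disjoint t t') :
    Disjoint (Submodule.span K (e '' t)) (Submodule.span K (e '' t')) := by
  have key := LinearIndependent.disjoint_span_image h (hd.preimage (Subtype.val : s → ι))
  have himg : ∀ u : Set ι, u ⊆ s →
      (fun x : s => e x) '' (Subtype.val ⁻¹' u : Set s) = e '' u := fun u hu => by
    rw [show (fun x : s => e x) = e ∘ Subtype.val from rfl, Set.image_comp,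
      Subtype.image_preimage_coe, Set.inter_eq_right.2 hu]
  rwa [himg t ht, himg t' ht'] at key

/-- The multigraded module `M` has the `K`-basis `e c`, where `c` runs over the exponents with
support in `P`, and monomials act on this basis by translation of exponents, so that `e c` behaves
like the monomial `x^c`; for the other exponents `e c = 0`. -/
structure IsMonomialSystem {K : Type*} [Field K] {n : ℕ} {M : Type*} [AddCommGroup M] [Module K M]
    [Module (MvPolynomial (Fin n) K) M] [IsScalarTower K (MvPolynomial (Fin n) K) M]
    (ℳ : (Fin n →₀ ℕ) → Submodule K M) (P : Set (Finset (Fin n)))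
    (e : (Fin n →₀ ℕ) → M) : Prop where
  eq_zero : ∀ c, c.support ∉ P → e c = 0
  -- In an ideal the formula fails for c outside `P`: there `e c = 0`, although `b + c` may have
  -- support in `P`.
  monomial_smul : ∀ b c, c.support ∈ P → MvPolynomial.monomial b (1 : K) • e c = e (b + c)
  linearIndepOn : LinearIndepOn K e {c | c.support ∈ P}
  span_eq_top : Submodule.span K (e '' {c | c.support ∈ P}) = ⊤
  component_eq : ∀ a, ℳ a = Submodule.span K {e a}

namespace IsMonomialSystem

variable {K : Type*} [Field K] {n : ℕ} {M : Type*} [AddCommGroup M] [Module K M]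
  [Module (MvPolynomial (Fin n) K) M] [IsScalarTower K (MvPolynomial (Fin n) K) M]
  {ℳ : (Fin n →₀ ℕ) → Submodule K M} {P : Set (Finset (Fin n))} {e : (Fin n →₀ ℕ) → M}

theorem mem_of_ne_zero (h : IsMonomialSystem ℳ P e) {c : Fin n →₀ ℕ} (hc : e c ≠ 0) :
    c.support ∈ P :=
  not_not.1 fun hP => hc (h.eq_zero c hP)

theorem ne_zero (h : IsMonomialSystem ℳ P e) {c : Fin n →₀ ℕ} (hc : c.support ∈ P) : e c ≠ 0 :=
  h.linearIndepOn.ne_zero hc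

/-- The scalar `k` is needed because a homogeneous generator is a basis element only up to a nonzero
factor. -/
theorem stanleySpace_eq (h : IsMonomialSystem ℳ P e) {a : Fin n →₀ ℕ} (ha : a.support ∈ P)
    {k : K} (hk : k ≠ 0) (Z : Finset (Fin n)) :
    stanleySpace (K := K) (k • e a) Z = Submodule.span K (e '' stanleyDegrees a Z) := by
  have hsmul : ∀ b : Fin n →₀ ℕ,
      MvPolynomial.monomial b (1 : K) • (k • e a) = k • e (b + a) := fun b => by
    rw [← h.monomial_smul b a ha, smul_algebra_smul_comm]
  apply le_antisymm
  · refine Submodule.span_le.2 ?_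
    rintro _ ⟨b, hb, rfl⟩
    rw [hsmul]
    exact Submodule.smul_mem _ _ (Submodule.subset_span ⟨_, ⟨b, hb, rfl⟩, rfl⟩)
  · refine Submodule.span_le.2 ?_
    rintro _ ⟨_, ⟨b, hb, rfl⟩, rfl⟩
    have hmem : k • e (b + a) ∈ stanleySpace (K := K) (k • e a) Z :=
      Submodule.subset_span ⟨b, hb, (hsmul b).symm⟩
    exact (Submodule.smul_mem_iff _ hk).1 hmem

/-- A squarefree Stanley decomposition yields an interval partition. -/
theorem hasIntervalPartition (h : IsMonomialSystem ℳ P e)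
    (D : SquarefreeStanleyDecomposition ℳ) : HasIntervalPartition P D.sreg := by
  classical
  have hu : ∀ i, ∃ k : K, k • e (D.deg i) = D.u i := fun i =>
    Submodule.mem_span_singleton.1 (h.component_eq (D.deg i) ▸ D.homogeneous i)
  choose k hk using hu
  have hu0 : ∀ i, D.u i ≠ 0 := fun i h0 =>
    one_ne_zero (D.free i 1 (one_mem _) (by rw [h0, smul_zero]))
  have hk0 : ∀ i, k i ≠ 0 := fun i h0 => hu0 i (by rw [← hk, h0, zero_smul])
  have hdeg : ∀ i, (D.deg i).support ∈ P := fun i =>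
    h.mem_of_ne_zero fun h0 => hu0 i (by rw [← hk, h0, smul_zero])
  have hspace : ∀ i, stanleySpace (K := K) (D.u i) (D.Z i) =
      Submodule.span K (e '' stanleyDegrees (D.deg i) (D.Z i)) := fun i => by
    rw [← hk i, h.stanleySpace_eq (hdeg i) (hk0 i)]
  -- Freeness enters here: if `e (b + a)` vanished, the monomial x^b would annihilate the generator.
  have hsub : ∀ i, stanleyDegrees (D.deg i) (D.Z i) ⊆ {c | c.support ∈ P} := by
    rintro i _ ⟨b, hb, rfl⟩
    refine h.mem_of_ne_zero fun h0 => ?_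
    have hsupp : MvPolynomial.monomial b (1 : K) ∈
        MvPolynomial.supported K (D.Z i : Set (Fin n)) := by
      rw [MvPolynomial.mem_supported, MvPolynomial.vars_monomial one_ne_zero]
      exact_mod_cast hb
    have hz := D.free i _ hsupp (by
      rw [← hk i, smul_algebra_smul_comm, h.monomial_smul b _ (hdeg i), h0, smul_zero])
    exact one_ne_zero (MvPolynomial.monomial_eq_zero.1 hz)
  have hmem : ∀ i (c : Fin n →₀ ℕ), c ∈ stanleyDegrees (D.deg i) (D.Z i) ↔
      (D.deg i).support ⊆ c.support ∧ c.support ⊆ D.Z i := fun i c =>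
    mem_stanleyDegrees_iff (D.deg_squarefree i) (D.support_subset i)
  -- The summands span, and each is spanned by basis vectors, so the basis vector of x^B already
  -- belongs to one of them.
  have hcover : ∀ B ∈ P, ∃ i, (D.deg i).support ⊆ B ∧ B ⊆ D.Z i := by
    intro B hB
    have htop : e (indicatorExponent B) ∈
        Submodule.span K (e '' ⋃ i, stanleyDegrees (D.deg i) (D.Z i)) := by
      rw [Set.image_iUnion, Submodule.span_iUnion]
      simp only [← hspace]
      rw [D.isInternal.submodule_iSup_eq_top]
      trivial
    obtain ⟨i, hi⟩ := Set.mem_iUnion.1 (h.linearIndepOn.mem_of_mem_span_image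
      (Set.iUnion_subset hsub) (by simpa using hB) htop)
    exact ⟨i, by simpa using (hmem i _).1 hi⟩
  -- If C lay in two intervals, the nonzero vector of x^C would lie in two independent summands.
  have huniq : ∀ i j C, (D.deg i).support ⊆ C → C ⊆ D.Z i → (D.deg j).support ⊆ C →
      C ⊆ D.Z j → i = j := by
    intro i j C hi hi' hj hj'
    by_contra hij
    have hci := (hmem i (indicatorExponent C)).2 (by simpa using ⟨hi, hi'⟩)
    have hcj := (hmem j (indicatorExponent C)).2 (by simpa using ⟨hj, hj'⟩)
    refine h.ne_zero (hsub i hci) (Submodule.disjoint_def.1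
      (D.isInternal.submodule_iSupIndep.pairwiseDisjoint hij) _ ?_ ?_)
    · exact (hspace i).ge (Submodule.subset_span ⟨_, hci, rfl⟩)
    · exact (hspace j).ge (Submodule.subset_span ⟨_, hcj, rfl⟩)
  choose idx hidx using hcover
  -- The value ∅ outside `P` is arbitrary; only members of `P` are constrained.
  refine ⟨fun B => if hB : B ∈ P then (D.deg (idx B hB)).support else ∅,
    fun B => if hB : B ∈ P then D.Z (idx B hB) else ∅, fun B hB => ?_⟩
  simp only [dif_pos hB]
  refine ⟨(hidx B hB).1, (hidx B hB).2, ?_, fun C hC hC' => ?_⟩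
  · exact (card_support_le_degree _).trans
      (Finset.le_sup (f := fun i => (D.deg i).degree) (Finset.mem_univ (idx B hB)))
  · have hCP : C ∈ P := by
      simpa using hsub _ ((hmem (idx B hB) (indicatorExponent C)).2 (by simpa using ⟨hC, hC'⟩))
    rw [dif_pos hCP, dif_pos hCP,
      huniq (idx C hCP) (idx B hB) C (hidx C hCP).1 (hidx C hCP).2 hC hC']
    exact ⟨hCP, rfl, rfl⟩

/-- An element `e a` generates a free `K[Z]`-module if all `x^b e a` with `x^b` in `K[Z]` are
nonzero. -/
theorem eq_zero_of_smul_eq_zero (h : IsMonomialSystem ℳ P e) {a : Fin n →₀ ℕ}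
    {Z : Finset (Fin n)} (haZ : stanleyDegrees a Z ⊆ {c | c.support ∈ P})
    {f : MvPolynomial (Fin n) K} (hf : f ∈ MvPolynomial.supported K (Z : Set (Fin n)))
    (hfa : f • e a = 0) : f = 0 := by
  classical
  have ha : a.support ∈ P := haZ ⟨0, by simp, by simp⟩
  have hsupp : ∀ b ∈ f.support, b.support ⊆ Z := fun b hb j hj => by
    have := MvPolynomial.mem_supported.1 hf
    exact_mod_cast this (MvPolynomial.mem_vars_iff_mem_support j |>.2 ⟨b, hb, hj⟩)
  have hexp : f • e a = ∑ b ∈ f.support, f.coeff b • e (b + a) := by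
    conv_lhs => rw [f.as_sum, Finset.sum_smul]
    refine Finset.sum_congr rfl fun b _ => ?_
    rw [← h.monomial_smul b a ha, ← smul_assoc, MvPolynomial.smul_monomial, smul_eq_mul, mul_one]
  -- Translation by `a` is injective, so the terms of `f • e a` are distinct basis vectors; `c - a`
  -- recovers the exponent in `f`.
  have hzero := linearIndepOn_iff'.1 h.linearIndepOn
    (f.support.image (· + a)) (fun c => f.coeff (c - a))
    (fun c hc => by
      obtain ⟨b, hb, rfl⟩ := Finset.mem_image.1 (Finset.mem_coe.1 hc)
      exact haZ ⟨b, hsupp b hb, rfl⟩)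
    (by
      rw [Finset.sum_image fun x _ y _ hxy => add_right_cancel hxy]
      simpa [← hexp] using hfa)
  ext b
  by_cases hb : b ∈ f.support
  · simpa using hzero (b + a) (Finset.mem_image_of_mem _ hb)
  · simpa using hb

/-- An interval partition yields a squarefree Stanley decomposition. -/
theorem exists_decomposition (h : IsMonomialSystem ℳ P e) {d : ℕ}
    (hP : HasIntervalPartition P d) :
    ∃ D : SquarefreeStanleyDecomposition ℳ, D.sreg ≤ d := by
  classical
  obtain ⟨lo, hi, hlohi⟩ := hP
  -- Each interval is represented once, by its least element, which is a fixed point of `lo`.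
  let T : Finset (Finset (Fin n)) := Finset.univ.filter fun A => A ∈ P ∧ lo A = A
  let A : Fin T.card → Finset (Fin n) := fun i => (T.equivFin.symm i : Finset (Fin n))
  have hA : ∀ i, A i ∈ P ∧ lo (A i) = A i := fun i =>
    (Finset.mem_filter.1 (T.equivFin.symm i).2).2
  have hAinj : Function.Injective A := Subtype.val_injective.comp T.equivFin.symm.injective
  have hAsurj : ∀ B ∈ P, lo B = B → ∃ i, A i = B := fun B hB hB' =>
    ⟨T.equivFin ⟨B, by simp [T, hB, hB']⟩, by simp [A]⟩
  have hAhi : ∀ i, A i ⊆ hi (A i) := fun i => (hlohi _ (hA i).1).2.1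
  have hmem : ∀ i (c : Fin n →₀ ℕ), c ∈ stanleyDegrees (indicatorExponent (A i)) (hi (A i)) ↔
      A i ⊆ c.support ∧ c.support ⊆ hi (A i) := fun i c => by
    rw [mem_stanleyDegrees_iff _ (by simpa using hAhi i), support_indicatorExponent]
    intro j
    rw [indicatorExponent_apply]
    split_ifs <;> simp
  have hint : ∀ i (c : Fin n →₀ ℕ), c ∈ stanleyDegrees (indicatorExponent (A i)) (hi (A i)) →
      c.support ∈ P ∧ lo c.support = A i := fun i c hc => by
    obtain ⟨h1, h2⟩ := (hmem i c).1 hc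
    have := (hlohi _ (hA i).1).2.2.2 c.support ((hA i).2.symm ▸ h1) h2
    exact ⟨this.1, this.2.1.trans (hA i).2⟩
  have hsub : ∀ i, stanleyDegrees (indicatorExponent (A i)) (hi (A i)) ⊆ {c | c.support ∈ P} :=
    fun i c hc => (hint i c hc).1
  have hspace : ∀ i, stanleySpace (K := K) (e (indicatorExponent (A i))) (hi (A i)) =
      Submodule.span K (e '' stanleyDegrees (indicatorExponent (A i)) (hi (A i))) := fun i => by
    rw [← h.stanleySpace_eq (by simpa using (hA i).1) (one_ne_zero (α := K)), one_smul]
  refine ⟨{ r := T.card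
            u := fun i => e (indicatorExponent (A i))
            deg := fun i => indicatorExponent (A i)
            Z := fun i => hi (A i)
            homogeneous := fun i => h.component_eq _ ▸ Submodule.mem_span_singleton_self _
            deg_squarefree := fun i j => by
              rw [indicatorExponent_apply]
              split_ifs <;> simp
            support_subset := fun i => by simpa using hAhi i
            free := fun i f hf hfa => h.eq_zero_of_smul_eq_zero (hsub i) hf hfa
            isInternal := ?_ }, ?_⟩
  · refine DirectSum.isInternal_submodule_of_iSupIndep_of_iSup_eq_top ?_ ?_
    · intro i
      simp only [hspace, ← Submodule.span_iUnion, ← Set.image_iUnion]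
      refine h.linearIndepOn.disjoint_span_image_of_disjoint (hsub i)
        (Set.iUnion₂_subset fun j _ => hsub j) ?_
      rw [Set.disjoint_iUnion₂_right]
      intro j hj
      refine Set.disjoint_left.2 fun c hci hcj => hj (hAinj ?_)
      exact (hint j c hcj).2.symm.trans (hint i c hci).2
    · simp only [hspace, ← Submodule.span_iUnion, ← Set.image_iUnion]
      rw [eq_top_iff, ← h.span_eq_top]
      refine Submodule.span_mono (Set.image_mono fun c hc => Set.mem_iUnion.2 ?_)
      obtain ⟨h1, h2, -, h3⟩ := hlohi _ hc
      -- The lower bound of an interval belongs to that interval, so it lies in `P`, is fixed by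
      -- `lo` and has the same upper bound.
      obtain ⟨hP, hlo, hhi⟩ := h3 (lo c.support) subset_rfl (h1.trans h2)
      obtain ⟨i, hi'⟩ := hAsurj _ hP hlo
      exact ⟨i, (hmem i c).2 (by rw [hi', hhi]; exact ⟨h1, h2⟩)⟩
  · refine Finset.sup_le fun i _ => ?_
    change (indicatorExponent (A i)).degree ≤ d
    rw [degree_indicatorExponent, ← (hA i).2]
    exact (hlohi _ (hA i).1).2.2.1

theorem stanleyRegularity_le_iff (h : IsMonomialSystem ℳ P e) {d : ℕ} :
    stanleyRegularity ℳ ≤ d ↔ ∃ d' ≤ d, HasIntervalPartition P d' := by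
  constructor
  · intro hd
    -- A strict bound on the infimum yields an actual decomposition with `sreg` below `d + 1`.
    have hlt : stanleyRegularity ℳ < ((d + 1 : ℕ) : ℕ∞) :=
      hd.trans_lt (by exact_mod_cast Nat.lt_succ_self d)
    obtain ⟨D, hD⟩ := iInf_lt_iff.1 hlt
    exact ⟨D.sreg, Nat.lt_succ_iff.1 (by exact_mod_cast hD), h.hasIntervalPartition D⟩
  · rintro ⟨d', hd', hP⟩
    obtain ⟨D, hD⟩ := h.exists_decomposition hP
    exact (iInf_le _ D).trans (by exact_mod_cast hD.trans hd')

end IsMonomialSystem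

/-- Stanley regularity is subadditive for intersections of the families of squarefree monomials
that are nonzero in the modules. -/
theorem stanleyRegularity_le_sum {K : Type*} [Field K] {n s : ℕ} {M : Type*} [AddCommGroup M]
    [Module K M] [Module (MvPolynomial (Fin n) K) M] [IsScalarTower K (MvPolynomial (Fin n) K) M]
    {ℳ : (Fin n →₀ ℕ) → Submodule K M} {e : (Fin n →₀ ℕ) → M}
    {N : Fin s → Type*} [∀ i, AddCommGroup (N i)] [∀ i, Module K (N i)]
    [∀ i, Module (MvPolynomial (Fin n) K) (N i)]
    [∀ i, IsScalarTower K (MvPolynomial (Fin n) K) (N i)]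
    {𝒩 : ∀ i, (Fin n →₀ ℕ) → Submodule K (N i)} {e' : ∀ i, (Fin n →₀ ℕ) → N i}
    {P : Fin s → Set (Finset (Fin n))} (h : IsMonomialSystem ℳ (⋂ i, P i) e)
    (h' : ∀ i, IsMonomialSystem (𝒩 i) (P i) (e' i)) :
    stanleyRegularity ℳ ≤ ∑ i, stanleyRegularity (𝒩 i) := by
  -- No existence of decompositions is required: a summand `⊤` makes the inequality trivial.
  by_cases htop : ∃ i, stanleyRegularity (𝒩 i) = ⊤
  · obtain ⟨i, hi⟩ := htop
    have : stanleyRegularity (𝒩 i) ≤ ∑ i, stanleyRegularity (𝒩 i) :=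
      Finset.single_le_sum (f := fun i => stanleyRegularity (𝒩 i)) (fun _ _ => zero_le)
        (Finset.mem_univ i)
    rw [hi, top_le_iff] at this
    exact this ▸ le_top
  · push Not at htop
    choose d hd using fun i => ENat.ne_top_iff_exists.1 (htop i)
    choose d' hd' hP using fun i => (h' i).stanleyRegularity_le_iff.1 (hd i).ge
    simp only [← hd]
    exact_mod_cast h.stanleyRegularity_le_iff.2
      ⟨∑ i, d' i, Finset.sum_le_sum fun i _ => hd' i, .iInter hP⟩

/-! ### Squarefree monomial ideals -/

/-- The ideal `I` is the span of the monomials with support in `U`. -/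
def IsSpannedBySupports {K : Type*} [Field K] {n : ℕ} (I : Ideal (MvPolynomial (Fin n) K))
    (U : Set (Finset (Fin n))) : Prop :=
  ∀ f, f ∈ I ↔ ∀ c ∈ f.support, c.support ∈ U

theorem sqfreeMonomial_eq_monomial (K : Type*) [Field K] {n : ℕ} (A : Finset (Fin n)) :
    sqfreeMonomial K A = MvPolynomial.monomial (indicatorExponent A) 1 := by
  rw [indicatorExponent, ← MvPolynomial.prod_X_pow (fun _ => 1) A]
  simp [sqfreeMonomial]

/-- Membership in a monomial ideal is tested on each monomial of `f`, and divisibility of x^c by the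
squarefree x^A sees only supp c. -/
theorem isSpannedBySupports_span {K : Type*} [Field K] {n : ℕ} (E : Set (Finset (Fin n))) :
    IsSpannedBySupports (Ideal.span (sqfreeMonomial K '' E)) {B | ∃ A ∈ E, A ⊆ B} := by
  intro f
  have himg : sqfreeMonomial K '' E =
      (fun c => MvPolynomial.monomial c (1 : K)) '' (indicatorExponent '' E) := by
    rw [Set.image_image]
    exact Set.image_congr fun A _ => sqfreeMonomial_eq_monomial K A
  rw [himg, MvPolynomial.mem_ideal_span_monomial_image]
  refine forall₂_congr fun c _ => ?_
  simp only [Set.exists_mem_image, Set.mem_ofPred_eq]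
  refine exists_congr fun A => and_congr_right fun _ => ?_
  constructor
  · intro hle
    simpa using Finsupp.support_mono hle
  · intro hA j
    rw [indicatorExponent_apply]
    split_ifs with hj
    · exact Nat.one_le_iff_ne_zero.2 (Finsupp.mem_support_iff.1 (hA hj))
    · exact Nat.zero_le _

namespace IsSpannedBySupports

variable {K : Type*} [Field K] {n : ℕ} {I : Ideal (MvPolynomial (Fin n) K)}
  {U : Set (Finset (Fin n))}

theorem monomial_mem_iff (h : IsSpannedBySupports I U) {c : Fin n →₀ ℕ} {k : K} (hk : k ≠ 0) :
    MvPolynomial.monomial c k ∈ I ↔ c.support ∈ U := by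
  classical
  rw [h, MvPolynomial.support_monomial, if_neg hk]
  simp

/-- The ideal contains every monomial occurring in one of its elements, so the monomials outside it
stay independent modulo it. -/
theorem isMonomialSystem_quotient (h : IsSpannedBySupports I U) :
    IsMonomialSystem (quotientComponent I) Uᶜ
      fun c => Ideal.Quotient.mk I (MvPolynomial.monomial c (1 : K)) where
  eq_zero c hc := Ideal.Quotient.eq_zero_iff_mem.2
    ((h.monomial_mem_iff one_ne_zero).2 (not_not.1 hc))
  monomial_smul b c _ := by
    rw [← Ideal.Quotient.mk_eq_mk, ← Ideal.Quotient.mk_eq_mk, ← Submodule.Quotient.mk_smul,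
      smul_eq_mul, MvPolynomial.monomial_mul, one_mul]
  linearIndepOn := by
    classical
    refine linearIndepOn_iff'.2 fun t g ht hsum c hc => ?_
    by_contra hgc
    have hmem : ∑ c ∈ t, MvPolynomial.monomial c (g c) ∈ I := by
      rw [← Ideal.Quotient.eq_zero_iff_mem, map_sum, ← hsum]
      refine Finset.sum_congr rfl fun c _ => ?_
      rw [← Ideal.Quotient.mkₐ_eq_mk K, ← map_smul, MvPolynomial.smul_monomial, smul_eq_mul,
        mul_one]
    refine ht (Finset.mem_coe.2 hc) ((h _).1 hmem c ?_)
    simpa [MvPolynomial.coeff_sum, MvPolynomial.coeff_monomial, hc] using hgc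
  span_eq_top := by
    rw [eq_top_iff]
    rintro x -
    obtain ⟨f, rfl⟩ := Ideal.Quotient.mk_surjective x
    rw [f.as_sum, map_sum]
    refine Submodule.sum_mem _ fun c _ => ?_
    have hc : Ideal.Quotient.mk I (MvPolynomial.monomial c (f.coeff c)) =
        f.coeff c • Ideal.Quotient.mk I (MvPolynomial.monomial c (1 : K)) := by
      rw [← Ideal.Quotient.mkₐ_eq_mk K, ← map_smul, MvPolynomial.smul_monomial, smul_eq_mul,
        mul_one]
    rw [hc]
    by_cases hcU : c.support ∈ U
    · rw [Ideal.Quotient.eq_zero_iff_mem.2 ((h.monomial_mem_iff one_ne_zero).2 hcU), smul_zero]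
      exact zero_mem _
    · exact Submodule.smul_mem _ _ (Submodule.subset_span ⟨c, hcU, rfl⟩)
  component_eq a := by
    rw [quotientComponent, polyComponent, Submodule.map_span, Set.image_singleton]
    rfl

-- The basis consists of the monomials in `I`. A monomial outside `I` is replaced by 0, which
-- matches I ∩ K x^a = 0 for such a.
open Classical in
theorem isMonomialSystem_ideal (h : IsSpannedBySupports I U) :
    IsMonomialSystem (idealComponent I) U fun c =>
      if hc : c.support ∈ U then
        ⟨MvPolynomial.monomial c (1 : K), (h.monomial_mem_iff one_ne_zero).2 hc⟩ else 0 where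
  eq_zero c hc := dif_neg hc
  monomial_smul b c hc := by
    -- `U` is not assumed closed under supersets; the ideal property of `I` supplies what is needed.
    have hbc : (b + c).support ∈ U := by
      rw [← h.monomial_mem_iff (one_ne_zero (α := K)), ← one_mul (1 : K),
        ← MvPolynomial.monomial_mul]
      exact I.mul_mem_left _ ((h.monomial_mem_iff one_ne_zero).2 hc)
    rw [dif_pos hc, dif_pos hbc]
    ext1
    simp [MvPolynomial.monomial_mul]
  linearIndepOn := by
    refine linearIndepOn_iff'.2 fun t g ht hsum c hc => ?_
    have hsum' := congrArg (fun x : I => MvPolynomial.coeff c (x : MvPolynomial (Fin n) K)) hsum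
    have hterm : ∀ b ∈ t, MvPolynomial.coeff c ((g b • (if hc : b.support ∈ U then
        (⟨MvPolynomial.monomial b (1 : K), (h.monomial_mem_iff one_ne_zero).2 hc⟩ : I)
        else 0) : I) : MvPolynomial (Fin n) K) = if b = c then g b else 0 := fun b hb => by
      rw [dif_pos (show b.support ∈ U from ht (Finset.mem_coe.2 hb))]
      simp [MvPolynomial.coeff_monomial]
    simp only [Submodule.coe_sum, MvPolynomial.coeff_sum] at hsum'
    rw [Finset.sum_congr rfl hterm] at hsum'
    simpa [hc] using hsum'
  span_eq_top := by
    rw [eq_top_iff]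
    rintro ⟨f, hf⟩ -
    have hU := (h f).1 hf
    have hsum : (⟨f, hf⟩ : I) = ∑ c ∈ f.support, f.coeff c • (if hc : c.support ∈ U then
        (⟨MvPolynomial.monomial c (1 : K), (h.monomial_mem_iff one_ne_zero).2 hc⟩ : I)
        else 0) := by
      ext1
      rw [Submodule.coe_sum]
      refine f.as_sum.trans (Finset.sum_congr rfl fun c hc => ?_)
      rw [dif_pos (hU c hc)]
      simp [MvPolynomial.smul_monomial]
    rw [hsum]
    exact Submodule.sum_mem _ fun c hc =>
      Submodule.smul_mem _ _ (Submodule.subset_span ⟨c, hU c hc, rfl⟩)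
  component_eq a := by
    ext ⟨f, hf⟩
    rw [idealComponent, polyComponent, Submodule.mem_comap, Submodule.mem_span_singleton,
      Submodule.mem_span_singleton]
    change (∃ k : K, k • MvPolynomial.monomial a (1 : K) = f) ↔ _
    split_ifs with ha
    · refine exists_congr fun k => ?_
      rw [Subtype.ext_iff]
      rfl
    · simp only [smul_zero, exists_const]
      rw [eq_comm (a := (0 : I)), Submodule.mk_eq_zero]
      constructor
      · rintro ⟨k, rfl⟩
        by_contra hne
        rw [MvPolynomial.smul_monomial, smul_eq_mul, mul_one] at hf hne
        exact ha ((h.monomial_mem_iff fun hk => hne (by rw [hk, map_zero])).1 hf)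
      · rintro rfl
        exact ⟨0, zero_smul _ _⟩

end IsSpannedBySupports

theorem mainTheorem6 {K : Type*} [Field K] (n s : ℕ)
    (I : Fin s → Ideal (MvPolynomial (Fin n) K))
    (hI : ∀ i, IsSquarefreeMonomialIdeal (I i)) :
    sregQuotient (∑ i, I i) ≤ ∑ i, sregQuotient (I i) ∧
      sregIdeal (⨅ i, I i) ≤ ∑ i, sregIdeal (I i) := by
  choose E hE using hI
  have hU : ∀ i, IsSpannedBySupports (I i) {B | ∃ A ∈ E i, A ⊆ B} := fun i => by
    rw [hE i]
    exact isSpannedBySupports_span (E i)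
  constructor
  -- A monomial lies in the sum iff it lies in some `I i`. The double complement exhibits the family
  -- of nonzero monomials of the quotient as an intersection.
  · have hsum : IsSpannedBySupports (∑ i, I i) (⋂ i, {B | ∃ A ∈ E i, A ⊆ B}ᶜ)ᶜ := by
      have heq : ∑ i, I i = Ideal.span (sqfreeMonomial K '' ⋃ i, E i) := by
        rw [Ideal.sum_eq_sup, Finset.sup_univ_eq_iSup, Set.image_iUnion, Ideal.span_iUnion]
        exact iSup_congr hE
      rw [heq]
      convert isSpannedBySupports_span (K := K) (⋃ i, E i) using 1
      ext B
      simp only [Set.mem_compl_iff, Set.mem_iInter, Set.mem_ofPred_eq, Set.mem_iUnion]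
      push Not
      tauto
    have h := hsum.isMonomialSystem_quotient
    rw [compl_compl] at h
    exact stanleyRegularity_le_sum h fun i => (hU i).isMonomialSystem_quotient
  · have hinf : IsSpannedBySupports (⨅ i, I i) (⋂ i, {B | ∃ A ∈ E i, A ⊆ B}) := fun f => by
      simp only [Ideal.mem_iInf, Set.mem_iInter]
      exact (forall_congr' fun i => hU i f).trans
        ⟨fun hf c hc i => hf i c hc, fun hf i c hc => hf c hc i⟩
    exact stanleyRegularity_le_sum hinf.isMonomialSystem_ideal
      fun i => (hU i).isMonomialSystem_ideal
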